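/- Let $g\ge 1$ and $n\ge 0$ be integers and put $m=2g$. Let $\mathrm{Sp}(2g,\mathbb Z)$ be the group of integer $m\times m$ matrices $K$ with $KJK^{t}=J$, where $J=\begin{pmatrix}0&-I_g\\ I_g&0\end{pmatrix}$ is the standard symplectic matrix. There is a constant $C>0$, depending only on $m$ and $n$, with the following property. Let $\|\cdot\|$ be any norm on the space $\mathrm M(n,m;\mathbb R)$ of real $n\times m$ matrices. Let $b^{(1)},\dots,b^{(n)}\in\mathbb R^m$ be vectors such that the family $b^{(1)},\dots,b^{(n)},\pi e_1,\dots,\pi e_m$ is linearly independent over $\mathbb Q$ in $\mathbb R^m$, where $e_1,\dots,e_m$ is the canonical basis, and let $B\in\mathrm M(n,m;\mathbb R)$ be the matrix whose $i$-th row is $b^{(i)}$. Then for every $A\in\mathrm M(n,m;\mathbb R)$ and every $\varepsilon>0$ there is $K\in\mathrm{Sp}(2g,\mathbb Z)$ such that $$\|A-BK\|<C\varepsilon \quad \text{mod } 2\pi,$$ that is, such that $\|A-2\pi H-BK\|<C\varepsilon$ for some integer matrix $H\in\mathrm M(n,m;\mathbb Z)$. -/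

import Mathlib

/-!
Dividing by `2π`, the claim is that the orbit of `B / 2π` under right multiplication by `Sp(2g, ℤ)`
is dense modulo integer matrices. Since `ε` is arbitrary and all norms on a finite-dimensional space
are equivalent, approximation of each entry suffices and the constant can be taken to be `1`. The
columns of the matrix are points of the torus `𝕋ⁿ`, and the symplectic matrices `(1 S; 0 1)` and
`(1 0; S 1)`, with `S` symmetric, add integer multiples of columns to other columns.

A single column need not generate a dense subgroup of `𝕋ⁿ`, whatever symplectic change of columns is
made: for a linear combination of the columns, infinitely many characters of `𝕋ⁿ` may have to be
avoided. The way round this is a uniform, quantitative form of Kronecker's theorem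
(`UnitAddTorus.exists_finset_forall_exists_norm_lt`): for each `ε` there is a *finite* set `F` of
nontrivial characters such that the multiples of `c` are `ε`-dense as soon as no character of `F` is
trivial at `c`. It follows from Weyl's averaging argument and the density of trigonometric
polynomials.

The linear independence hypothesis says that for each `q ≠ 0` the row `q B / 2π` has an irrational
entry. For finitely many `q` at once, generic transvections spread the irrationality to all entries
without destroying it anywhere (`SymplecticGroup.exists_forall_irrational`), so all columns become
`ε`-generating. Then with `S` diagonal, adding multiples of column `i` to column `g + i` brings the
latter close to its target; the multiples avoid finitely many bad values, so that column `g + i`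
remains `ε`-generating, and a multiple of it can be added to column `i` to bring that one close to
its target too (`SymplecticGroup.exists_approx`).
-/

open Filter Topology Matrix

/-! ### Generic integer combinations of two reals -/

/-- At most one `k` makes `x + k y` rational. -/
theorem irrational_add_eventually {x y : ℝ} (h : Irrational x ∨ Irrational y) :
    ∀ᶠ k : ℕ in atTop, Irrational (x + k * y) := by
  have hs : {k : ℕ | ¬ Irrational (x + k * y)}.Subsingleton := by
    intro k hk l hl
    by_contra hkl
    have hkl' : ((l : ℚ) - k) ≠ 0 := sub_ne_zero.2 (by exact_mod_cast Ne.symm hkl)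
    have hkl'' : ((l : ℝ) - k) ≠ 0 := sub_ne_zero.2 (by exact_mod_cast Ne.symm hkl)
    simp only [Irrational, Set.mem_ofPred_eq, not_not] at hk hl
    obtain ⟨r, hr⟩ := hk
    obtain ⟨s, hs⟩ := hl
    have hy : y = (((s - r) / (l - k) : ℚ) : ℝ) := by
      push_cast
      rw [hr, hs]
      field_simp
      ring
    rcases h with h | h
    · refine h ⟨r - k * ((s - r) / (l - k)), ?_⟩
      push_cast at hy ⊢
      rw [← hy, hr]
      ring
    · exact h ⟨_, hy.symm⟩
  have := hs.finite.compl_mem_cofinite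
  rw [Nat.cofinite_eq_atTop] at this
  filter_upwards [this] with k hk
  simpa using hk

/-! ### A uniform Kronecker theorem -/

theorem UnitAddTorus.mFourier_add_nsmul {d : Type*} [Fintype d] (q : d → ℤ)
    (z c : UnitAddTorus d) (k : ℕ) :
    UnitAddTorus.mFourier q (z + k • c) =
      UnitAddTorus.mFourier q z * UnitAddTorus.mFourier q c ^ k := by
  simp only [UnitAddTorus.mFourier, ContinuousMap.coe_mk, ← Finset.prod_pow,
    ← Finset.prod_mul_distrib]
  refine Finset.prod_congr rfl fun i _ => ?_
  have h : (q i) • (z + k • c) i = q i • z i + k • (q i • c i) := by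
    simp [smul_add, smul_comm (q i) k]
  simp only [fourier_apply, h, AddCircle.toCircle_add, AddCircle.toCircle_nsmul, Circle.coe_mul,
    Circle.coe_pow]

theorem tendsto_average_pow {w : ℂ} (hw : ‖w‖ = 1) (h1 : w ≠ 1) :
    Tendsto (fun M : ℕ => (M : ℂ)⁻¹ * ∑ k ∈ Finset.range M, w ^ k) atTop (𝓝 0) := by
  refine Tendsto.zero_mul_isBoundedUnder_le tendsto_inv_atTop_nhds_zero_nat ?_
  refine isBoundedUnder_of ⟨2 / ‖w - 1‖, fun M => ?_⟩
  simp only [Function.comp_apply]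
  rw [geom_sum_eq h1, norm_div]
  gcongr
  calc ‖w ^ M - 1‖ ≤ ‖w ^ M‖ + ‖(1 : ℂ)‖ := norm_sub_le _ _
    _ = 2 := by rw [norm_pow, hw]; norm_num

/-- **Weyl averaging.** The averages of a trigonometric polynomial along an arithmetic progression
`z + k • c` tend to its constant term `m`, provided that the nontrivial characters `F` occurring in
it are not trivial at the step `c`. -/
theorem exists_finset_tendsto_average {d : Type*} [Fintype d] {p : C(UnitAddTorus d, ℂ)}
    (hp : p ∈ Submodule.span ℂ (Set.range (UnitAddTorus.mFourier (d := d)))) :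
    ∃ (F : Finset (d → ℤ)) (m : ℂ), 0 ∉ F ∧ ∀ c : UnitAddTorus d,
      (∀ q ∈ F, UnitAddTorus.mFourier q c ≠ 1) → ∀ z : UnitAddTorus d,
        Tendsto (fun M : ℕ => (M : ℂ)⁻¹ * ∑ k ∈ Finset.range M, p (z + k • c)) atTop (𝓝 m) := by
  classical
  induction hp using Submodule.span_induction with
  | mem p hp =>
    obtain ⟨q, rfl⟩ := hp
    by_cases hq : q = 0
    · refine ⟨∅, 1, by simp, fun c _ z => ?_⟩
      subst hq
      refine tendsto_const_nhds.congr' ?_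
      filter_upwards [eventually_ne_atTop 0] with M hM
      simp [UnitAddTorus.mFourier_zero, hM]
    · refine ⟨{q}, 0, by simpa using Ne.symm hq, fun c hc z => ?_⟩
      have hw : ‖UnitAddTorus.mFourier q c‖ = 1 := by
        simp [UnitAddTorus.mFourier, fourier_apply, norm_prod, -fourier_coe_apply', Circle.norm_coe]
      have := (tendsto_average_pow hw (hc q (by simp))).const_mul (UnitAddTorus.mFourier q z)
      rw [mul_zero] at this
      refine this.congr fun M => ?_
      simp only [UnitAddTorus.mFourier_add_nsmul, ← Finset.mul_sum]
      ring
  | zero => exact ⟨∅, 0, by simp, fun c _ z => by simp⟩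
  | add p r _ _ hp hr =>
    obtain ⟨F, m, h0, h⟩ := hp
    obtain ⟨F', m', h0', h'⟩ := hr
    refine ⟨F ∪ F', m + m', by simp [h0, h0'], fun c hc z => ?_⟩
    refine ((h c (fun q hq => hc q (by simp [hq])) z).add
      (h' c (fun q hq => hc q (by simp [hq])) z)).congr fun M => ?_
    simp [Finset.sum_add_distrib, mul_add]
  | smul a p _ hp =>
    obtain ⟨F, m, h0, h⟩ := hp
    refine ⟨F, a * m, h0, fun c hc z => ((h c hc z).const_mul a).congr fun M => ?_⟩
    simp [← Finset.mul_sum]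
    ring

theorem norm_average_le {u : ℕ → ℂ} {η : ℝ} (hη : 0 ≤ η) (hu : ∀ k, ‖u k‖ ≤ η) (M : ℕ) :
    ‖(M : ℂ)⁻¹ * ∑ k ∈ Finset.range M, u k‖ ≤ η := by
  rw [norm_mul, norm_inv, Complex.norm_natCast]
  rcases Nat.eq_zero_or_pos M with rfl | hM
  · simpa using hη
  rw [inv_mul_le_iff₀ (by exact_mod_cast hM)]
  exact (norm_sum_le_of_le _ fun k _ => hu k).trans (by simp)

/-- **Uniform Kronecker theorem.** Being `ε`-dense, for the multiples of a point `c` of a torus, can be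
tested on finitely many characters that depend only on `ε`. -/
theorem UnitAddTorus.exists_finset_forall_exists_norm_lt {d : Type*} [Fintype d] {ε : ℝ}
    (hε : 0 < ε) :
    ∃ F : Finset (d → ℤ), 0 ∉ F ∧ ∀ c : UnitAddTorus d,
      (∀ q ∈ F, UnitAddTorus.mFourier q c ≠ 1) →
        ∀ a : UnitAddTorus d, ∃ k : ℕ, ‖a - k • c‖ < ε := by
  classical
  -- A bump function `f` supported in the ball of radius `ε` is approximated by a trigonometric
  -- polynomial `p`. The translates of `f` by the finite `ε / 2`-net `t` sum to at least `ε / 2`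
  -- everywhere, which bounds the constant term `m` of `p` from below.
  let f : C(UnitAddTorus d, ℂ) :=
    ⟨fun x => ((max 0 (ε - ‖x‖) : ℝ) : ℂ), by fun_prop⟩
  obtain ⟨t, -, ht, hcov⟩ := (isCompact_univ (X := UnitAddTorus d)).finite_cover_balls
    (half_pos hε)
  lift t to Finset (UnitAddTorus d) using ht
  set r : ℝ := (t.card : ℝ)
  have hr : 0 ≤ r := Nat.cast_nonneg _
  set η : ℝ := ε / (8 * (r + 1))
  have hη : 0 < η := by positivity
  obtain ⟨p, hp, hpf⟩ : ∃ p ∈ Submodule.span ℂ (Set.range (UnitAddTorus.mFourier (d := d))),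
      dist f p < η := by
    refine Metric.mem_closure_iff.1 ?_ η hη
    rw [← Submodule.topologicalClosure_coe, UnitAddTorus.span_mFourier_closure_eq_top]
    trivial
  have hpf' : ∀ x, ‖p x - f x‖ ≤ η := fun x => by
    rw [← dist_eq_norm, dist_comm]
    exact (ContinuousMap.dist_apply_le_dist x).trans hpf.le
  obtain ⟨F, m, h0, hF⟩ := exists_finset_tendsto_average hp
  refine ⟨F, h0, fun c hc a => ?_⟩
  by_contra! hk
  -- If the progression misses the `ε`-ball around `a`, then `f` vanishes along its translate by `-a`,
  -- which bounds `m` from above.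
  have hm : ‖m‖ ≤ η := by
    refine le_of_tendsto (hF c hc (-a)).norm (Eventually.of_forall fun M => ?_)
    refine norm_average_le hη.le (fun k => ?_) M
    have h := hpf' (-a + k • c)
    have h2 : ‖-a + k • c‖ = ‖a - k • c‖ := by rw [← norm_neg]; congr 1; abel
    have : f (-a + k • c) = 0 := by
      simp only [f, ContinuousMap.coe_mk, h2, Complex.ofReal_eq_zero, max_eq_left_iff]
      linarith [hk k]
    simpa [this] using h
  have hsum : Tendsto (fun M : ℕ => (M : ℂ)⁻¹ * ∑ k ∈ Finset.range M, ∑ y ∈ t, p (-y + k • c))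
      atTop (𝓝 (∑ _y ∈ t, m)) := by
    refine (tendsto_finsetSum t fun y _ => hF c hc (-y)).congr fun M => ?_
    rw [← Finset.mul_sum, Finset.sum_comm]
  have hre : ε / 2 - r * η ≤ (∑ _y ∈ t, m).re := by
    refine ge_of_tendsto ((Complex.continuous_re.tendsto _).comp hsum) ?_
    filter_upwards [eventually_gt_atTop 0] with M hM
    have hM' : (0 : ℝ) < M := by exact_mod_cast hM
    have hcast : ((M : ℂ)⁻¹ * ∑ k ∈ Finset.range M, ∑ y ∈ t, p (-y + k • c)).re =
        (M : ℝ)⁻¹ * ∑ k ∈ Finset.range M, ∑ y ∈ t, (p (-y + k • c)).re := by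
      rw [← Complex.ofReal_natCast, ← Complex.ofReal_inv, Complex.re_ofReal_mul]
      simp
    rw [Function.comp_apply, hcast, le_inv_mul_iff₀ hM']
    have hle : ∀ k ∈ Finset.range M, ε / 2 - r * η ≤ ∑ y ∈ t, (p (-y + k • c)).re := by
      intro k _
      have hpt : ∀ y, max 0 (ε - ‖-y + k • c‖) - η ≤ (p (-y + k • c)).re := fun y => by
        have h := (Complex.abs_re_le_norm _).trans (hpf' (-y + k • c))
        rw [Complex.sub_re] at h
        have h2 : (f (-y + k • c)).re = max 0 (ε - ‖-y + k • c‖) := rfl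
        rw [h2] at h
        linarith [(abs_le.1 h).1]
      obtain ⟨y₀, hy₀, hd⟩ : ∃ y ∈ t, dist (k • c) y < ε / 2 := by
        simpa using hcov (Set.mem_univ (k • c))
      calc ε / 2 - r * η ≤ ∑ y ∈ t, max 0 (ε - ‖-y + k • c‖) - r * η := by
            gcongr
            refine le_trans ?_ (Finset.single_le_sum
              (f := fun y => max 0 (ε - ‖-y + k • c‖)) (fun _ _ => le_max_left _ _) hy₀)
            refine le_max_of_le_right ?_
            rw [neg_add_eq_sub, ← dist_eq_norm]
            linarith
        _ = ∑ y ∈ t, (max 0 (ε - ‖-y + k • c‖) - η) := by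
            rw [Finset.sum_sub_distrib, Finset.sum_const, nsmul_eq_mul]
        _ ≤ _ := Finset.sum_le_sum fun y _ => hpt y
    simpa only [Finset.sum_const, Finset.card_range, nsmul_eq_mul] using Finset.sum_le_sum hle
  have hup : (∑ _y ∈ t, m).re ≤ r * η := by
    rw [Finset.sum_const, nsmul_eq_mul]
    refine (Complex.re_le_norm _).trans ?_
    rw [norm_mul, Complex.norm_natCast]
    exact mul_le_mul_of_nonneg_left hm hr
  have : η * (8 * (r + 1)) = ε := div_mul_cancel₀ _ (by positivity)
  nlinarith

theorem mFourier_coe_ne_one {d : Type*} [Fintype d] {q : d → ℤ} {c : d → ℝ}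
    (h : Irrational (∑ i, q i * c i)) :
    UnitAddTorus.mFourier q (fun i => (c i : UnitAddCircle)) ≠ 1 := by
  have hexp : UnitAddTorus.mFourier q (fun i => (c i : UnitAddCircle)) =
      Complex.exp (2 * Real.pi * Complex.I * ((∑ i, q i * c i : ℝ) : ℂ)) := by
    push_cast
    rw [Finset.mul_sum, Complex.exp_sum]
    simp only [UnitAddTorus.mFourier, ContinuousMap.coe_mk]
    refine Finset.prod_congr rfl fun i _ => ?_
    rw [fourier_coe_apply]
    congr 1
    push_cast
    ring
  rw [hexp, Ne, Complex.exp_eq_one_iff]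
  rintro ⟨k, hk⟩
  rw [mul_comm (k : ℂ)] at hk
  have := mul_left_cancel₀ Complex.two_pi_I_ne_zero hk
  exact h ⟨k, by exact_mod_cast this.symm⟩

/-- The form of the uniform Kronecker theorem used for column operations: if no character in `F` takes
a rational value on the column `c`, a multiple of `c` can be added to `c'` to bring it `ε`-close to
`a` modulo integers, and the new column again has irrational values on `F`. -/
theorem exists_finset_forall_exists_translate {d : Type*} [Fintype d] {ε : ℝ} (hε : 0 < ε) :
    ∃ F : Finset (d → ℤ), 0 ∉ F ∧ ∀ c c' a : d → ℝ, (∀ q ∈ F, Irrational (∑ i, q i * c i)) →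
      ∃ k : ℤ, (∃ h : d → ℤ, ∀ i, |a i - h i - (c' i + k * c i)| < ε) ∧
        ∀ q ∈ F, Irrational (∑ i, q i * (c' i + k * c i)) := by
  obtain ⟨F, h0, hF⟩ := UnitAddTorus.exists_finset_forall_exists_norm_lt (d := d) hε
  refine ⟨F, h0, fun c c' a hc => ?_⟩
  have hev : ∀ᶠ k : ℕ in atTop, ∀ q ∈ F,
      Irrational ((∑ i, q i * c' i) + k * ∑ i, q i * c i) :=
    (eventually_all_finset F).2 fun q hq => irrational_add_eventually (.inr (hc q hq))
  -- All coefficients from `k₀` on keep the new column irrational on `F`, so the approximation is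
  -- carried out starting from `c' + k₀ c`.
  obtain ⟨k₀, hk₀⟩ := eventually_atTop.1 hev
  obtain ⟨k, hk⟩ := hF (fun i => (c i : UnitAddCircle)) (fun q hq => mFourier_coe_ne_one (hc q hq))
    (fun i => ((a i - c' i - k₀ * c i : ℝ) : UnitAddCircle))
  refine ⟨((k₀ + k : ℕ) : ℤ), ⟨fun i => round (a i - c' i - k₀ * c i - k * c i), fun i => ?_⟩,
    fun q hq => ?_⟩
  · have hi := (pi_norm_lt_iff hε).1 hk i
    have hcoe : (((a i - c' i - k₀ * c i - k * c i : ℝ)) : UnitAddCircle) =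
        ((a i - c' i - k₀ * c i : ℝ) : UnitAddCircle) - k • (c i : UnitAddCircle) := by
      rw [AddCircle.coe_sub, ← nsmul_eq_mul k, AddCircle.coe_nsmul]
    simp only [Pi.sub_apply, Pi.smul_apply] at hi
    rw [← hcoe, UnitAddCircle.norm_eq] at hi
    convert hi using 2
    push_cast
    ring
  · convert hk₀ (k₀ + k) (Nat.le_add_right _ _) q hq using 1
    rw [Finset.mul_sum, ← Finset.sum_add_distrib]
    refine Finset.sum_congr rfl fun i _ => ?_
    push_cast
    ring

/-! ### Symplectic column operations -/

theorem Matrix.map_intCast_mul {m : Type*} [Fintype m] (K L : Matrix m m ℤ) :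
    (K * L).map (Int.cast : ℤ → ℝ) = K.map Int.cast * L.map Int.cast :=
  Matrix.map_mul (f := Int.castRingHom ℝ)

theorem Matrix.isSymm_permMatrix_swap {l : Type*} [DecidableEq l] (i j : l) :
    ((Equiv.swap i j).permMatrix ℤ).IsSymm := by
  rw [IsSymm, transpose_permMatrix, Equiv.swap_inv]

section Symplectic

variable {ι l : Type*} [Fintype l] [DecidableEq l]

theorem SymplecticGroup.fromBlocks_upper_mem {S : Matrix l l ℤ} (hS : S.IsSymm) :
    fromBlocks 1 S 0 1 ∈ symplecticGroup l ℤ := by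
  rw [mem_iff, J, fromBlocks_transpose, hS]
  simp [fromBlocks_multiply]

theorem SymplecticGroup.fromBlocks_lower_mem {S : Matrix l l ℤ} (hS : S.IsSymm) :
    fromBlocks 1 0 S 1 ∈ symplecticGroup l ℤ := by
  rw [mem_iff, J, fromBlocks_transpose, hS]
  simp [fromBlocks_multiply]

/-- If each of finitely many real rows has an irrational entry, one integral symplectic matrix makes
all the entries of all the rows irrational. -/
theorem SymplecticGroup.exists_forall_irrational [Finite ι] (V : Matrix ι (l ⊕ l) ℝ)
    (hV : ∀ r, ∃ j, Irrational (V r j)) :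
    ∃ K ∈ symplecticGroup l ℤ, ∀ r j, Irrational ((V * K.map (Int.cast : ℤ → ℝ)) r j) := by
  let G (K : Matrix (l ⊕ l) (l ⊕ l) ℤ) : Set (ι × (l ⊕ l)) :=
    {p | Irrational ((V * K.map (Int.cast : ℤ → ℝ)) p.1 p.2)}
  -- Choose `K` so that the set `G K` of irrational entries is maximal.
  obtain ⟨_, h1, ⟨K, hK, rfl⟩, hmax⟩ :=
    (Set.toFinite (G '' (symplecticGroup l ℤ : Set _))).exists_le_maximal
      (Set.mem_image_of_mem G (one_mem (symplecticGroup l ℤ)))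
  set W := V * K.map (Int.cast : ℤ → ℝ)
  -- The transvections `1 + t • M` with `t` generic keep all irrational entries of `W` and make the
  -- entry of `W` irrational wherever that of `W * M` is; by maximality, it already was.
  have hstep : ∀ M : Matrix (l ⊕ l) (l ⊕ l) ℤ, (∀ t : ℕ, 1 + t • M ∈ symplecticGroup l ℤ) →
      ∀ r j, Irrational ((W * M.map (Int.cast : ℤ → ℝ)) r j) → Irrational (W r j) := by
    intro M hM r j hr
    have hev : ∀ᶠ t : ℕ in atTop, ∀ (s : ι) (a : l ⊕ l),
        Irrational (W s a) ∨ Irrational ((W * M.map (Int.cast : ℤ → ℝ)) s a) →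
          Irrational (W s a + t * (W * M.map (Int.cast : ℤ → ℝ)) s a) :=
      eventually_all.2 fun s => eventually_all.2 fun a => by
        by_cases h : Irrational (W s a) ∨ Irrational ((W * M.map (Int.cast : ℤ → ℝ)) s a)
        · filter_upwards [irrational_add_eventually h] with t ht _ using ht
        · exact .of_forall fun _ h' => absurd h' h
    obtain ⟨t, ht⟩ := hev.exists
    have hprod : V * (K * (1 + t • M)).map (Int.cast : ℤ → ℝ) =
        W + (t : ℝ) • (W * M.map (Int.cast : ℤ → ℝ)) := by
      have hmap : (1 + t • M).map (Int.cast : ℤ → ℝ) = 1 + (t : ℝ) • M.map Int.cast := by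
        ext a b
        by_cases hab : a = b <;> simp [Matrix.smul_apply, hab, -nsmul_eq_mul]
      rw [map_intCast_mul, ← Matrix.mul_assoc, hmap, Matrix.mul_add, Matrix.mul_one,
        Matrix.mul_smul]
    have hG : ∀ s a, (s, a) ∈ G (K * (1 + t • M)) ↔
        Irrational (W s a + t * (W * M.map (Int.cast : ℤ → ℝ)) s a) := fun s a => by
      simp only [G, Set.mem_ofPred_eq, hprod, Matrix.add_apply, Matrix.smul_apply, smul_eq_mul]
    exact hmax (Set.mem_image_of_mem G (mul_mem hK (hM t)))
      (fun ⟨s, a⟩ h => (hG s a).2 (ht s a (.inl h))) ((hG r j).2 (ht r j (.inr hr)))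
  -- The matrix of the transposition of `i` and `j` is symmetric, and its column `j` is the `i`-th basis
  -- vector, so irrationality passes from entry `i` of one half to entry `j` of the other half.
  have hlr : ∀ r i j, Irrational (W r (.inl i)) → Irrational (W r (.inr j)) := by
    intro r i j hr
    refine hstep (fromBlocks 0 ((Equiv.swap i j).permMatrix ℤ) 0 0) (fun t => ?_) r _ ?_
    · rw [← fromBlocks_one, fromBlocks_smul, fromBlocks_add]
      simpa using fromBlocks_upper_mem ((isSymm_permMatrix_swap i j).smul t)
    · simpa [Matrix.mul_apply, Fintype.sum_sum_type, Equiv.Perm.permMatrix,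
        PEquiv.toMatrix_apply, Equiv.swap_apply_eq_iff] using hr
  have hrl : ∀ r i j, Irrational (W r (.inr i)) → Irrational (W r (.inl j)) := by
    intro r i j hr
    refine hstep (fromBlocks 0 0 ((Equiv.swap i j).permMatrix ℤ) 0) (fun t => ?_) r _ ?_
    · rw [← fromBlocks_one, fromBlocks_smul, fromBlocks_add]
      simpa using fromBlocks_lower_mem ((isSymm_permMatrix_swap i j).smul t)
    · simpa [Matrix.mul_apply, Fintype.sum_sum_type, Equiv.Perm.permMatrix,
        PEquiv.toMatrix_apply, Equiv.swap_apply_eq_iff] using hr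
  refine ⟨K, hK, fun r j => ?_⟩
  obtain ⟨j₀, hj₀⟩ := hV r
  have h0 : Irrational (W r j₀) :=
    h1 (a := (r, j₀)) (by simpa [G] using hj₀)
  rcases j₀ with i | i <;> rcases j with j | j
  · exact hrl r j j (hlr r i j h0)
  · exact hlr r i j h0
  · exact hrl r i j h0
  · exact hlr r j j (hrl r i j h0)

/-- Density of `Sp(2g, ℤ)`-orbits modulo integer matrices: the columns of `B` can be brought within
`ε` of those of `A` if every nontrivial integer combination of the rows of `B` has an irrational
entry. -/
theorem SymplecticGroup.exists_approx {d : Type*} [Fintype d] (B : Matrix d (l ⊕ l) ℝ)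
    (hB : ∀ q : d → ℤ, q ≠ 0 → ∃ j, Irrational (∑ i, q i * B i j))
    (A : Matrix d (l ⊕ l) ℝ) {ε : ℝ} (hε : 0 < ε) :
    ∃ K ∈ symplecticGroup l ℤ, ∃ H : Matrix d (l ⊕ l) ℤ,
      ∀ i j, |A i j - H i j - (B * K.map (Int.cast : ℤ → ℝ)) i j| < ε := by
  obtain ⟨F, h0, hF⟩ := exists_finset_forall_exists_translate (d := d) hε
  let Q : Matrix F d ℝ := .of fun q i => (q.1 i : ℝ)
  obtain ⟨K₀, hK₀, hirr⟩ := exists_forall_irrational (Q * B) fun q =>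
    hB q.1 fun h => h0 (h ▸ q.2)
  rw [Matrix.mul_assoc] at hirr
  set B₀ := B * K₀.map (Int.cast : ℤ → ℝ)
  replace hirr : ∀ j, ∀ q ∈ F, Irrational (∑ i, q i * B₀ i j) := fun j q hq => hirr ⟨q, hq⟩ j
  -- First move the right half of the columns, keeping them irrational on `F`, then the left half.
  choose k hk hkF using fun j : l => hF (fun i => B₀ i (.inl j)) (fun i => B₀ i (.inr j))
    (fun i => A i (.inr j)) (hirr (.inl j))
  choose hr hhr using hk
  set U : Matrix (l ⊕ l) (l ⊕ l) ℤ := fromBlocks 1 (diagonal k) 0 1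
  set B₁ := B₀ * U.map (Int.cast : ℤ → ℝ)
  have hB₁l : ∀ i j, B₁ i (.inl j) = B₀ i (.inl j) := fun i j => by
    simp [B₁, U, Matrix.mul_apply, Fintype.sum_sum_type, Matrix.one_apply]
  have hB₁r : ∀ i j, B₁ i (.inr j) = B₀ i (.inr j) + k j * B₀ i (.inl j) := fun i j => by
    simp [B₁, U, Matrix.mul_apply, Fintype.sum_sum_type, Matrix.one_apply, diagonal_apply,
      mul_comm, add_comm]
  simp only [← hB₁r] at hhr hkF
  choose m hm _ using fun j : l => hF (fun i => B₁ i (.inr j)) (fun i => B₀ i (.inl j))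
    (fun i => A i (.inl j)) (hkF j)
  choose hl hhl using hm
  set L : Matrix (l ⊕ l) (l ⊕ l) ℤ := fromBlocks 1 0 (diagonal m) 1
  have hL : ∀ i, ∀ j, (B₁ * L.map (Int.cast : ℤ → ℝ)) i j =
      Sum.elim (fun j => B₀ i (.inl j) + m j * B₁ i (.inr j)) (fun j => B₁ i (.inr j)) j := by
    rintro i (j | j)
    · simp [L, Matrix.mul_apply, Fintype.sum_sum_type, Matrix.one_apply, diagonal_apply,
        mul_comm, hB₁l]
    · simp [L, Matrix.mul_apply, Fintype.sum_sum_type, Matrix.one_apply]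
  refine ⟨K₀ * U * L, mul_mem (mul_mem hK₀ (fromBlocks_upper_mem (isSymm_diagonal k)))
    (fromBlocks_lower_mem (isSymm_diagonal m)), .of fun i => Sum.elim (hl · i) (hr · i), ?_⟩
  have hprod : B * (K₀ * U * L).map (Int.cast : ℤ → ℝ) = B₁ * L.map (Int.cast : ℤ → ℝ) := by
    rw [map_intCast_mul, map_intCast_mul, ← Matrix.mul_assoc, ← Matrix.mul_assoc]
  intro i j
  rw [hprod, hL]
  rcases j with j | j
  · exact hhl j i
  · exact hhr j i

end Symplectic

/-! ### Reduction to entrywise approximation -/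

theorem Seminorm.le_sum_abs_mul_single {m n : Type*} [Fintype m] [Fintype n] [DecidableEq m]
    [DecidableEq n] (N : Seminorm ℝ (Matrix m n ℝ)) (X : Matrix m n ℝ) :
    N X ≤ ∑ i, ∑ j, |X i j| * N (Matrix.single i j 1) := by
  conv_lhs => rw [Matrix.matrix_eq_sum_single X]
  refine (Finset.le_sum_of_subadditive N (map_zero N).le (map_add_le_add N) _ _).trans
    (Finset.sum_le_sum fun i _ => ?_)
  refine (Finset.le_sum_of_subadditive N (map_zero N).le (map_add_le_add N) _ _).trans
    (Finset.sum_le_sum fun j _ => ?_)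
  rw [← Real.norm_eq_abs, ← map_smul_eq_mul, Matrix.smul_single, smul_eq_mul, mul_one]

/-- Independence of the rows `b i` and the vectors `π eⱼ` over `ℚ` means that no nontrivial integer
combination of the rows lies in `π ℚᵐ = 2π ℚᵐ`. -/
theorem exists_irrational_of_linearIndependent {d m : Type*} [Fintype d] [Fintype m]
    [DecidableEq m] {b : d → m → ℝ}
    (hb : LinearIndependent ℚ
      (Sum.elim b fun j : m => Real.pi • (Pi.single j 1 : m → ℝ)))
    {q : d → ℤ} (hq : q ≠ 0) : ∃ j, Irrational (∑ i, q i * ((2 * Real.pi)⁻¹ * b i j)) := by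
  by_contra! h
  simp only [Irrational, Set.mem_range, not_not] at h
  choose r hr using h
  refine hq (funext fun i => ?_)
  have := Fintype.linearIndependent_iff.1 hb (Sum.elim (fun i => (q i : ℚ)) fun j => -2 * r j) ?_
    (.inl i)
  · simpa using this
  ext j
  have hj : ∑ i, q i * b i j = 2 * Real.pi * r j := by
    rw [hr, Finset.mul_sum]
    refine Finset.sum_congr rfl fun i _ => ?_
    field_simp
  simp only [Fintype.sum_sum_type, Sum.elim_inl, Sum.elim_inr, Finset.sum_apply,
    Pi.smul_apply, Pi.single_apply, Rat.smul_def, Pi.zero_apply, smul_eq_mul]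
  simp [hj]
  ring

theorem theoremC (g n : ℕ) (hg : 1 ≤ g) :
    ∃ C : ℝ, 0 < C ∧
      -- an arbitrary norm on the space of real `n × 2g` matrices
      ∀ N : Seminorm ℝ (Matrix (Fin n) (Fin g ⊕ Fin g) ℝ), (∀ X, N X = 0 → X = 0) →
      ∀ b : Fin n → (Fin g ⊕ Fin g → ℝ),
        LinearIndependent ℚ
          (Sum.elim b (fun j : Fin g ⊕ Fin g => Real.pi • (Pi.single j 1 : Fin g ⊕ Fin g → ℝ))) →
      ∀ (A : Matrix (Fin n) (Fin g ⊕ Fin g) ℝ) (ε : ℝ), 0 < ε →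
        ∃ K ∈ Matrix.symplecticGroup (Fin g) ℤ,
          -- the inequality modulo `2π`: up to an integer matrix times `2π`
          ∃ H : Matrix (Fin n) (Fin g ⊕ Fin g) ℤ,
            N (A - (2 * Real.pi) • H.map (Int.cast : ℤ → ℝ)
                - Matrix.of b * K.map (Int.cast : ℤ → ℝ)) < C * ε := by
  refine ⟨1, one_pos, fun N _ b hb A ε hε => ?_⟩
  have hpi : 0 < 2 * Real.pi := Real.two_pi_pos
  set s : ℝ := ∑ i, ∑ j, N (Matrix.single i j 1)
  have hs : 0 ≤ s := Finset.sum_nonneg fun i _ => Finset.sum_nonneg fun j _ => apply_nonneg N _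
  set δ : ℝ := ε / (2 * Real.pi * (s + 1))
  have hδ : 0 < δ := by positivity
  obtain ⟨K, hK, H, hH⟩ := SymplecticGroup.exists_approx ((2 * Real.pi)⁻¹ • Matrix.of b)
    (fun q hq => exists_irrational_of_linearIndependent hb hq) ((2 * Real.pi)⁻¹ • A) hδ
  refine ⟨K, hK, H, ?_⟩
  set X := A - (2 * Real.pi) • H.map (Int.cast : ℤ → ℝ) - Matrix.of b * K.map (Int.cast : ℤ → ℝ)
  have hX : ∀ i j, |X i j| ≤ 2 * Real.pi * δ := fun i j => by
    have : X i j = 2 * Real.pi * (((2 * Real.pi)⁻¹ • A) i j - H i j -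
        ((2 * Real.pi)⁻¹ • Matrix.of b * K.map (Int.cast : ℤ → ℝ)) i j) := by
      rw [Matrix.smul_mul]
      simp only [X, Matrix.sub_apply, Matrix.smul_apply, Matrix.map_apply, smul_eq_mul, mul_sub,
        mul_inv_cancel_left₀ hpi.ne']
    rw [this, abs_mul, abs_of_pos hpi]
    exact mul_le_mul_of_nonneg_left (hH i j).le hpi.le
  calc N X ≤ ∑ i, ∑ j, |X i j| * N (Matrix.single i j 1) := N.le_sum_abs_mul_single X
    _ ≤ ∑ i, ∑ j, 2 * Real.pi * δ * N (Matrix.single i j 1) := by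
      gcongr with i _ j _
      exact hX i j
    _ = 2 * Real.pi * δ * s := by simp only [s, Finset.mul_sum]
    _ < 2 * Real.pi * δ * (s + 1) := by gcongr; linarith
    _ = 1 * ε := by
      simp only [δ]
      field_simp
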